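/- For $\mathbb F\in\{\mathbb C,\mathbb H\}$ ($\mathbb H$ the quaternions, $\mathbb C=\mathrm{span}_{\mathbb R}\{1,i\}\subset\mathbb H$) and an $n\times n$ matrix $A$ over $\mathbb F$, let $W_{\mathbb F}(A)=\{x^*Ax : x\in\mathbb F^n,\ |x|=1\}$. For a complex matrix $A\in M_n(\mathbb C)$, let $B(A)=W_{\mathbb H}(A)\cap\mathbb C$ be its bild and $B^+(A)=B(A)\cap\{z\in\mathbb C:\operatorname{Im}z\ge 0\}$ its upper bild, and put $$v_{\min}=\min\,(B(A)\cap\mathbb R),\qquad v_{\max}=\max\,(B(A)\cap\mathbb R).$$ **Corollary.** Let $n\ge 1$ and let $A=H+Si\in M_n(\mathbb C)$ with $H,S\in M_n(\mathbb C)$ Hermitian; if $n=1$, assume $S=0$ (for $n=1$ and $S\ne0$ the set $B(A)\cap\mathbb R$ is empty). Then the minimum $v_{\min}$ and the maximum $v_{\max}$ exist, and: 1. if $S$ is positive semidefinite, then $B^+(A)=\operatorname{conv}\big(W_{\mathbb C}(A)\cup\{v_{\min},v_{\max}\}\big)$; 2. if $S$ is negative semidefinite, then $B^+(A)=\operatorname{conv}\big(W_{\mathbb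 C}(A^*)\cup\{v_{\min},v_{\max}\}\big)$. -/

import Mathlib

open scoped Matrix Quaternion ComplexOrder

noncomputable section

/-- The numerical range `{x* A x : x ∈ 𝔽ⁿ, |x| = 1}` of a square matrix over `𝔽`
(used for `𝔽 = ℂ` and `𝔽 = ℍ`). The order of the factors is the one of `x* A x`. -/
def numericalRange {F : Type*} [NormedRing F] [StarRing F] {n : ℕ}
    (A : Matrix (Fin n) (Fin n) F) : Set F :=
  {w | ∃ x : Fin n → F, ∑ i, ‖x i‖ ^ 2 = 1 ∧ w = star x ⬝ᵥ (A *ᵥ x)}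

/-- A complex matrix regarded as a quaternionic matrix, `ℂ = span {1, i} ⊆ ℍ`. -/
def quaternionMatrix {n : ℕ} (A : Matrix (Fin n) (Fin n) ℂ) : Matrix (Fin n) (Fin n) ℍ[ℝ] :=
  A.map Quaternion.coeComplex

/-- The bild `B(A)`: the complex elements of the quaternionic numerical range. -/
def bild {n : ℕ} (A : Matrix (Fin n) (Fin n) ℂ) : Set ℂ :=
  {z | Quaternion.coeComplex z ∈ numericalRange (quaternionMatrix A)}

/-- The upper bild `B⁺(A)`: the part of the bild in the closed upper half-plane. -/
def upperBild {n : ℕ} (A : Matrix (Fin n) (Fin n) ℂ) : Set ℂ :=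
  bild A ∩ {z | 0 ≤ z.im}

/-- The real elements `B(A) ∩ ℝ` of the bild. -/
def realBild {n : ℕ} (A : Matrix (Fin n) (Fin n) ℂ) : Set ℝ :=
  {r | (r : ℂ) ∈ bild A}

/-- The number `min (B(A) ∩ ℝ)`, when this minimum exists. -/
def vMin {n : ℕ} (A : Matrix (Fin n) (Fin n) ℂ) : ℝ := sInf (realBild A)

/-- The number `max (B(A) ∩ ℝ)`, when this maximum exists. -/
def vMax {n : ℕ} (A : Matrix (Fin n) (Fin n) ℂ) : ℝ := sSup (realBild A)

end

/-! Writing a quaternionic vector as `u + v j` with complex `u`, `v`, a complex number lies in `B(H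
+ Si)` exactly when it is `(u*Hu + v*Hv) + i(u*Su - v*Sv)` with `|u|² + |v|² = 1` and `u*Sv = 0`
(`mem_bild_add_I_smul_iff`). If `S ≥ 0` and the imaginary part is nonnegative, shrinking `u` to `tu`
balances the two `S`-values and leaves the orthogonality intact. So the pair `(tu, v)` yields a real
point of the bild, and the remaining share of `u` yields a point of `W_ℂ(A)`; their weights add up
to 1 (`upperBild_subset_convexHull`). Conversely, the bild is star-shaped about its real points, by
the argument that also gives Toeplitz–Hausdorff over ℂ (`segment_subset_numericalRange`), and the
hull is a union of segments from real bild points to `W_ℂ(A)`. The negative case follows from `B(A*)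
= B(A)`. -/

section Form

variable {F : Type*} {n : ℕ}

/-- Expansion of the sesquilinear form of `M` on a right linear combination. -/
theorem form_combination [Ring F] [StarRing F] (M : Matrix (Fin n) (Fin n) F)
    (x y : Fin n → F) (a b : F) :
    star (fun i => y i * a + x i * b) ⬝ᵥ M *ᵥ (fun i => y i * a + x i * b) =
      star a * (star y ⬝ᵥ M *ᵥ y) * a + star a * (star y ⬝ᵥ M *ᵥ x) * b +
      star b * (star x ⬝ᵥ M *ᵥ y) * a + star b * (star x ⬝ᵥ M *ᵥ x) * b := by
  simp only [dotProduct, Matrix.mulVec, Pi.star_apply, star_add, star_mul, Finset.mul_sum,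
    Finset.sum_mul, ← Finset.sum_add_distrib]
  refine Finset.sum_congr rfl fun i _ => Finset.sum_congr rfl fun j _ => ?_
  noncomm_ring

theorem form_sub_scalar [Ring F] [StarRing F] (M : Matrix (Fin n) (Fin n) F) (c : F)
    (x : Fin n → F) :
    star x ⬝ᵥ (M - Matrix.scalar (Fin n) c) *ᵥ x =
      star x ⬝ᵥ M *ᵥ x - ∑ i, star (x i) * c * x i := by
  rw [Matrix.sub_mulVec, dotProduct_sub]
  congr 1
  simp [dotProduct, Matrix.mulVec_diagonal, Matrix.scalar_apply, mul_assoc]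

/-- Either `L` is bijective and attains `w`, or a nonzero kernel vector works with `c = 0`. -/
theorem exists_ne_zero_map_eq_smul [NormedDivisionRing F] [NormedAlgebra ℝ F]
    [FiniteDimensional ℝ F] (L : F →ₗ[ℝ] F) {w : F} (hw : w ≠ 0) :
    ∃ q : F, q ≠ 0 ∧ ∃ c : ℝ, L q = c • w := by
  by_cases h : Function.Injective L
  · obtain ⟨q, hq⟩ := (LinearMap.injective_iff_surjective.1 h) w
    refine ⟨q, ?_, 1, by simpa using hq⟩
    rintro rfl
    exact hw (by simpa using hq.symm)
  · rw [← LinearMap.ker_eq_bot] at h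
    replace h := (Submodule.ne_bot_iff _).1 h
    obtain ⟨q, hq, hq0⟩ := h
    exact ⟨q, hq0, 0, by simpa using hq⟩

/-- If one value of the numerical range is central, then the segment joining it to any other value
is contained in the numerical range. -/
theorem segment_subset_numericalRange [NormedDivisionRing F] [NormedAlgebra ℝ F] [StarRing F]
    [StarModule ℝ F] [FiniteDimensional ℝ F]
    (hF : ∀ a : F, star a * a = algebraMap ℝ F (‖a‖ ^ 2))
    (A : Matrix (Fin n) (Fin n) F) {c d : F} (hc : ∀ a, c * a = a * c)
    (hcA : c ∈ numericalRange A) (hdA : d ∈ numericalRange A) :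
    segment ℝ c d ⊆ numericalRange A := by
  obtain ⟨x, hx, hcx⟩ := hcA
  obtain ⟨y, hy, hdy⟩ := hdA
  rintro _ ⟨α, τ, hα, hτ, hατ, rfl⟩
  rcases eq_or_ne d c with rfl | hdc
  · rw [← add_smul, hατ, one_smul]
    exact ⟨x, hx, hcx⟩
  -- Subtracting the central value `c` makes the form vanish at `x` and equal `d - c` at `y`.
  set M := A - Matrix.scalar (Fin n) c with hM
  have hform : ∀ z : Fin n → F,
      star z ⬝ᵥ A *ᵥ z = star z ⬝ᵥ M *ᵥ z + (∑ i, ‖z i‖ ^ 2) • c := by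
    intro z
    rw [hM, form_sub_scalar, Finset.sum_smul, eq_comm, sub_add_eq_add_sub, sub_eq_iff_eq_add]
    congr 1
    refine Finset.sum_congr rfl fun i _ => ?_
    rw [mul_assoc, hc, ← mul_assoc, hF, Algebra.smul_def]
  have hMx : star x ⬝ᵥ M *ᵥ x = 0 := by
    have := hform x
    rw [hx, one_smul, ← hcx] at this
    simpa using this.symm
  have hMy : star y ⬝ᵥ M *ᵥ y = d - c := by
    have := hform y
    rw [hy, one_smul, ← hdy] at this
    rw [this]; simp
  have hw : d - c ≠ 0 := sub_ne_zero.2 hdc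
  -- Rotating `x` by a suitable `q` makes the cross terms a real multiple of `d - c`, so the form
  -- along the path `z` stays on one real line; the intermediate value theorem then finds the ratio
  -- `τ`.
  let L : F →ₗ[ℝ] F :=
    { toFun := fun q => (star y ⬝ᵥ M *ᵥ x) * q + star q * (star x ⬝ᵥ M *ᵥ y)
      map_add' := fun a b => by simp only [star_add]; noncomm_ring
      map_smul' := fun r a => by simp [star_smul, smul_add] }
  obtain ⟨q, hq, k, hk⟩ := exists_ne_zero_map_eq_smul L hw
  replace hk : (star y ⬝ᵥ M *ᵥ x) * q + star q * (star x ⬝ᵥ M *ᵥ y) = k • (d - c) := hk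
  have hsr : ∀ s : ℝ, star (algebraMap ℝ F s) = algebraMap ℝ F s := fun s => by
    rw [Algebra.algebraMap_eq_smul_one, star_smul, star_one, star_trivial]
  let z : ℝ → Fin n → F := fun s i =>
    y i * algebraMap ℝ F s + x i * (algebraMap ℝ F (1 - s) * q)
  have hz : ∀ s, star (z s) ⬝ᵥ M *ᵥ z s = (s ^ 2 + s * (1 - s) * k) • (d - c) := by
    intro s
    rw [form_combination, hMx, hMy, star_mul, hsr, hsr, add_smul, mul_smul _ k, ← hk]
    simp only [Algebra.algebraMap_eq_smul_one, smul_mul_assoc, mul_smul_comm, one_mul, mul_one,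
      mul_zero, zero_mul, smul_add, smul_smul, add_zero, smul_zero]
    rw [← add_assoc, sq, mul_comm (1 - s) s]
  have hNpos : ∀ s, 0 < ∑ i, ‖z s i‖ ^ 2 := by
    intro s
    refine lt_of_le_of_ne (by positivity) fun h => ?_
    have h0 : ∀ i, z s i = 0 := fun i => by
      have := (Finset.sum_eq_zero_iff_of_nonneg (fun i _ => by positivity)).1 h.symm i
        (Finset.mem_univ _)
      simpa using this
    -- If `z s = 0`, then `y s` is a right multiple of `x`, where the form of `M` vanishes; but its
    -- value at `y s` is `s²(d - c)`, so `s = 0`, and then `x q = 0` forces `x = 0`.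
    have e1 : (fun i => y i * algebraMap ℝ F s + x i * 0) =
        fun i => y i * 0 + x i * (-(algebraMap ℝ F (1 - s) * q)) := by
      funext i
      have := h0 i
      simp only [z] at this
      rw [mul_zero, mul_zero, add_zero, zero_add, mul_neg]
      exact eq_neg_of_add_eq_zero_left this
    have e2 := form_combination M x y (algebraMap ℝ F s) 0
    rw [e1, form_combination] at e2
    rw [hMx, hMy] at e2
    simp only [star_zero, mul_zero, zero_mul, add_zero, hsr] at e2
    have hs : s = 0 := by
      have := e2.symm
      rcases mul_eq_zero.1 this with h | h
      · rcases mul_eq_zero.1 h with h | h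
        · simpa using h
        · exact absurd h hw
      · simpa using h
    have hx0 : ∀ i, x i = 0 := fun i => by
      have := h0 i
      simp only [z, hs] at this
      simpa [hq] using this
    simp [hx0] at hx
  obtain ⟨s, hs⟩ : ∃ s : ℝ, s ^ 2 + s * (1 - s) * k - τ * ∑ i, ‖z s i‖ ^ 2 = 0 := by
    have hcont : Continuous fun s : ℝ =>
        s ^ 2 + s * (1 - s) * k - τ * ∑ i, ‖z s i‖ ^ 2 := by
      have : Continuous (algebraMap ℝ F) := continuous_algebraMap ℝ F
      simp only [z]
      fun_prop
    have hmem : (0 : ℝ) ∈ Set.Icc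
        ((0:ℝ) ^ 2 + 0 * (1 - 0) * k - τ * ∑ i, ‖z 0 i‖ ^ 2)
        ((1:ℝ) ^ 2 + 1 * (1 - 1) * k - τ * ∑ i, ‖z 1 i‖ ^ 2) := by
      constructor
      · have := mul_nonneg hτ (hNpos 0).le
        linarith
      · have : ∑ i, ‖z 1 i‖ ^ 2 = 1 := by simpa [z] using hy
        rw [this]
        linarith
    obtain ⟨s, -, h⟩ := intermediate_value_Icc zero_le_one hcont.continuousOn hmem
    exact ⟨s, h⟩
  set N := ∑ i, ‖z s i‖ ^ 2 with hN
  have hN0 : 0 < N := hNpos s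
  have hsq : (√N)⁻¹ ^ 2 * N = 1 := by
    rw [inv_pow, Real.sq_sqrt hN0.le, inv_mul_cancel₀ hN0.ne']
  -- The vacuous term `x i * 0` lets `form_combination` handle a plain rescaling.
  refine ⟨fun i => z s i * algebraMap ℝ F (√N)⁻¹ + x i * 0, ?_, ?_⟩
  · simp only [mul_zero, add_zero, norm_mul, mul_pow, ← Finset.sum_mul, ← hN, norm_algebraMap',
      Real.norm_eq_abs, sq_abs]
    rw [mul_comm, hsq]
  · rw [form_combination, hform (z s), hz, ← hN, sub_eq_zero.1 hs]
    simp only [star_zero, mul_zero, zero_mul, add_zero, hsr]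
    simp only [Algebra.algebraMap_eq_smul_one, smul_mul_assoc, mul_smul_comm, one_mul, mul_one]
    rw [smul_smul, ← sq, smul_add, smul_smul, smul_smul, mul_left_comm, hsq, mul_one, one_smul,
      eq_sub_iff_add_eq.2 hατ, smul_sub, sub_smul, one_smul]
    abel

end Form

/-- The Toeplitz–Hausdorff theorem. -/
theorem convex_numericalRange {n : ℕ} (A : Matrix (Fin n) (Fin n) ℂ) :
    Convex ℝ (numericalRange A) :=
  convex_iff_segment_subset.2 fun _ hc _ hd =>
    segment_subset_numericalRange (fun a => by simpa using Complex.conj_mul' a) A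
      (fun a => mul_comm _ a) hc hd

theorem starModule_real_quaternion : StarModule ℝ ℍ[ℝ] :=
  ⟨fun r a => by ext <;> simp⟩

/-- The bild is star-shaped with respect to each of its real points. -/
theorem segment_subset_bild {n : ℕ} (A : Matrix (Fin n) (Fin n) ℂ) {r : ℝ} {z : ℂ}
    (hr : r ∈ realBild A) (hz : z ∈ bild A) : segment ℝ (r : ℂ) z ⊆ bild A := by
  have := starModule_real_quaternion
  rintro _ ⟨a, b, ha, hb, hab, rfl⟩
  refine segment_subset_numericalRange
    (fun a => by rw [Quaternion.star_mul_self, Quaternion.normSq_eq_norm_mul_self, sq]; rfl)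
    (quaternionMatrix A) (c := Quaternion.coeComplex r) (d := Quaternion.coeComplex z) ?_ hr hz
    ⟨a, b, ha, hb, hab, ?_⟩
  · intro a
    rw [Quaternion.coeComplex_coe]
    exact Quaternion.coe_commutes r a
  · ext <;> simp

/-! ### Quaternionic forms in complex coordinates -/

/-- The quaternion `u + v j`. -/
def quaternionOfPair (u v : ℂ) : ℍ[ℝ] := ⟨u.re, u.im, v.re, v.im⟩

@[simp]
theorem quaternionOfPair_re (u v : ℂ) : (quaternionOfPair u v).re = u.re := rfl

@[simp]
theorem quaternionOfPair_imI (u v : ℂ) : (quaternionOfPair u v).imI = u.im := rfl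

@[simp]
theorem quaternionOfPair_imJ (u v : ℂ) : (quaternionOfPair u v).imJ = v.re := rfl

@[simp]
theorem quaternionOfPair_imK (u v : ℂ) : (quaternionOfPair u v).imK = v.im := rfl

theorem norm_sq_quaternionOfPair (u v : ℂ) :
    ‖quaternionOfPair u v‖ ^ 2 = ‖u‖ ^ 2 + ‖v‖ ^ 2 := by
  rw [sq, ← Quaternion.normSq_eq_norm_mul_self, Quaternion.normSq_def', Complex.sq_norm,
    Complex.sq_norm, Complex.normSq_apply, Complex.normSq_apply]
  simp only [quaternionOfPair]
  ring

theorem quaternionOfPair_sum {ι : Type*} (s : Finset ι) (u v : ι → ℂ) :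
    ∑ i ∈ s, quaternionOfPair (u i) (v i) = quaternionOfPair (∑ i ∈ s, u i) (∑ i ∈ s, v i) := by
  classical
  induction s using Finset.induction_on with
  | empty => ext <;> simp
  | insert a s ha ih =>
    rw [Finset.sum_insert ha, Finset.sum_insert ha, Finset.sum_insert ha, ih]
    ext <;> simp

theorem star_quaternionOfPair_mul (u v u' v' a : ℂ) :
    star (quaternionOfPair u v) * (Quaternion.coeComplex a * quaternionOfPair u' v') =
      quaternionOfPair (star u * (a * u') + star (star v * (a * v')))
        (star u * (a * v') - star (star v * (a * u'))) := by
  ext <;> simp <;> ring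

theorem quaternionOfPair_form {n : ℕ} (A : Matrix (Fin n) (Fin n) ℂ) (u v : Fin n → ℂ) :
    star (fun i => quaternionOfPair (u i) (v i)) ⬝ᵥ
        (quaternionMatrix A *ᵥ fun i => quaternionOfPair (u i) (v i)) =
      quaternionOfPair (star u ⬝ᵥ A *ᵥ u + star (star v ⬝ᵥ A *ᵥ v))
        (star u ⬝ᵥ A *ᵥ v - star (star v ⬝ᵥ A *ᵥ u)) := by
  simp only [dotProduct, Matrix.mulVec, Pi.star_apply, Finset.mul_sum, quaternionMatrix,
    Matrix.map_apply, star_quaternionOfPair_mul, quaternionOfPair_sum, Finset.sum_add_distrib,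
    Finset.sum_sub_distrib, star_sum]

theorem mem_bild_iff {n : ℕ} (A : Matrix (Fin n) (Fin n) ℂ) (z : ℂ) :
    z ∈ bild A ↔ ∃ u v : Fin n → ℂ, ∑ i, ‖u i‖ ^ 2 + ∑ i, ‖v i‖ ^ 2 = 1 ∧
      star u ⬝ᵥ A *ᵥ v = star (star v ⬝ᵥ A *ᵥ u) ∧
      z = star u ⬝ᵥ A *ᵥ u + star (star v ⬝ᵥ A *ᵥ v) := by
  have key : ∀ p q : ℂ, Quaternion.coeComplex z = quaternionOfPair p q ↔ z = p ∧ q = 0 := by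
    intro p q
    rw [Quaternion.ext_iff, Complex.ext_iff, Complex.ext_iff]
    simp only [quaternionOfPair_re, quaternionOfPair_imI, quaternionOfPair_imJ,
      quaternionOfPair_imK, Quaternion.re_coeComplex, Quaternion.imI_coeComplex, Quaternion.imJ_coeComplex,
      Quaternion.imK_coeComplex, Complex.zero_re, Complex.zero_im, eq_comm (a := (0 : ℝ)), and_assoc]
  constructor
  · rintro ⟨x, hx, h⟩
    let u : Fin n → ℂ := fun i => ⟨(x i).re, (x i).imI⟩
    let v : Fin n → ℂ := fun i => ⟨(x i).imJ, (x i).imK⟩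
    have hxe : x = fun i => quaternionOfPair (u i) (v i) := rfl
    rw [hxe, quaternionOfPair_form, key, sub_eq_zero] at h
    refine ⟨u, v, ?_, h.2, h.1⟩
    rw [← hx, ← Finset.sum_add_distrib]
    exact Finset.sum_congr rfl fun i _ => (norm_sq_quaternionOfPair _ _).symm
  · rintro ⟨u, v, h1, h2, h3⟩
    refine ⟨fun i => quaternionOfPair (u i) (v i), ?_, ?_⟩
    · simp only [norm_sq_quaternionOfPair, Finset.sum_add_distrib, h1]
    · rw [quaternionOfPair_form, key, sub_eq_zero]
      exact ⟨h3, h2⟩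

theorem star_form {n : ℕ} (A : Matrix (Fin n) (Fin n) ℂ) (u v : Fin n → ℂ) :
    star (star u ⬝ᵥ A *ᵥ v) = star v ⬝ᵥ Aᴴ *ᵥ u := by
  rw [← Matrix.star_dotProduct, Matrix.star_mulVec, Matrix.dotProduct_mulVec]

/-- Swapping `u` and `v` turns a representation for `Aᴴ` into one for `A`. -/
theorem bild_conjTranspose_subset {n : ℕ} (A : Matrix (Fin n) (Fin n) ℂ) :
    bild Aᴴ ⊆ bild A := by
  intro z hz
  obtain ⟨u, v, h1, h2, h3⟩ := (mem_bild_iff _ _).1 hz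
  refine (mem_bild_iff _ _).2 ⟨v, u, by rw [add_comm, h1], ?_, ?_⟩
  · rw [← star_form, ← star_form, star_star] at h2
    rw [← h2, star_star]
  · rw [h3, ← star_form, ← star_form, star_star, add_comm]

theorem bild_conjTranspose {n : ℕ} (A : Matrix (Fin n) (Fin n) ℂ) : bild Aᴴ = bild A := by
  refine (bild_conjTranspose_subset A).antisymm ?_
  conv_lhs => rw [← Matrix.conjTranspose_conjTranspose A]
  exact bild_conjTranspose_subset Aᴴ

/-! ### Compactness of the real bild -/

theorem isCompact_realBild {n : ℕ} (A : Matrix (Fin n) (Fin n) ℂ) : IsCompact (realBild A) := by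
  have hsphere : IsCompact {x : Fin n → ℍ[ℝ] | ∑ i, ‖x i‖ ^ 2 = 1} := by
    refine Metric.isCompact_of_isClosed_isBounded
      (isClosed_eq (by fun_prop) continuous_const) ?_
    refine (Metric.isBounded_closedBall (x := 0) (r := 1)).subset fun x hx => ?_
    rw [mem_closedBall_zero_iff, pi_norm_le_iff_of_nonneg zero_le_one]
    intro i
    have h : ‖x i‖ ^ 2 ≤ 1 := by
      rw [← show ∑ i, ‖x i‖ ^ 2 = 1 from hx]
      exact Finset.single_le_sum (f := fun i => ‖x i‖ ^ 2) (fun _ _ => by positivity)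
        (Finset.mem_univ i)
    exact (sq_le_one_iff₀ (norm_nonneg _)).1 h
  have himage : IsCompact (numericalRange (quaternionMatrix A)) := by
    have hcont : Continuous fun x : Fin n → ℍ[ℝ] => star x ⬝ᵥ quaternionMatrix A *ᵥ x := by
      have : ContinuousStar ℍ[ℝ] :=
        ⟨AddMonoidHomClass.continuous_of_bound (starAddEquiv : ℍ[ℝ] ≃+ ℍ[ℝ]) 1
          fun x => by simp⟩
      simp only [dotProduct, Matrix.mulVec, Pi.star_apply]
      fun_prop
    convert hsphere.image hcont using 1
    ext w
    simp only [numericalRange, Set.mem_ofPred_eq, Set.mem_image, eq_comm]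
  have hiso : Isometry fun r : ℝ => (r : ℍ[ℝ]) :=
    Isometry.of_dist_eq fun r s => by
      rw [dist_eq_norm, ← Quaternion.coe_sub, Quaternion.norm_coe, dist_eq_norm]
  have := hiso.isClosedEmbedding.isCompact_preimage himage
  convert this using 1
  ext r
  simp [realBild, bild]

/-! ### Cartesian decomposition and normalization -/

theorem hermitian_form_eq {n : ℕ} {S : Matrix (Fin n) (Fin n) ℂ} (hS : S.IsHermitian)
    (u v : Fin n → ℂ) : star (star u ⬝ᵥ S *ᵥ v) = star v ⬝ᵥ S *ᵥ u := by
  rw [star_form, hS.eq]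

theorem form_add_I_smul {n : ℕ} (H S : Matrix (Fin n) (Fin n) ℂ) (u v : Fin n → ℂ) :
    star u ⬝ᵥ (H + Complex.I • S) *ᵥ v =
      star u ⬝ᵥ H *ᵥ v + Complex.I * (star u ⬝ᵥ S *ᵥ v) := by
  rw [Matrix.add_mulVec, dotProduct_add, Matrix.smul_mulVec, dotProduct_smul, smul_eq_mul]

/-- The value `u* M u` of a Hermitian form, as a real number. -/
theorem hermitian_form_real {n : ℕ} {S : Matrix (Fin n) (Fin n) ℂ} (hS : S.IsHermitian)
    (u : Fin n → ℂ) : star u ⬝ᵥ S *ᵥ u = ((star u ⬝ᵥ S *ᵥ u).re : ℂ) :=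
  (Complex.conj_eq_iff_re.1 (hermitian_form_eq hS u u)).symm

/-- In the condition killing the `j`-part the `H`-terms cancel, leaving only `u*Sv = 0`. -/
theorem mem_bild_add_I_smul_iff {n : ℕ} {H S : Matrix (Fin n) (Fin n) ℂ}
    (hH : H.IsHermitian) (hS : S.IsHermitian) (z : ℂ) :
    z ∈ bild (H + Complex.I • S) ↔ ∃ u v : Fin n → ℂ,
      ∑ i, ‖u i‖ ^ 2 + ∑ i, ‖v i‖ ^ 2 = 1 ∧ star u ⬝ᵥ S *ᵥ v = 0 ∧
      z = (star u ⬝ᵥ H *ᵥ u + star v ⬝ᵥ H *ᵥ v) +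
        Complex.I * (star u ⬝ᵥ S *ᵥ u - star v ⬝ᵥ S *ᵥ v) := by
  rw [mem_bild_iff]
  refine exists_congr fun u => exists_congr fun v => and_congr Iff.rfl (and_congr ?_ ?_)
  · simp only [form_add_I_smul, star_add, star_mul', hermitian_form_eq hH, hermitian_form_eq hS,
      Complex.star_def, Complex.conj_I]
    rw [show ∀ p q : ℂ, (p + Complex.I * q = p + -Complex.I * q ↔ q = 0) from fun p q => ?_]
    constructor
    · intro h
      have : 2 * Complex.I * q = 0 := by linear_combination h
      simpa using this
    · rintro rfl; simp
  · simp only [form_add_I_smul, star_add, star_mul', hermitian_form_eq hH, hermitian_form_eq hS,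
      Complex.star_def, Complex.conj_I]
    ring_nf

theorem form_smul {n : ℕ} (M : Matrix (Fin n) (Fin n) ℂ) (c d : ℂ) (u v : Fin n → ℂ) :
    star (c • u) ⬝ᵥ M *ᵥ (d • v) = star c * d * (star u ⬝ᵥ M *ᵥ v) := by
  rw [Matrix.mulVec_smul, dotProduct_smul, star_smul, smul_dotProduct, smul_eq_mul, smul_eq_mul]
  ring

theorem form_real_smul_self {n : ℕ} (M : Matrix (Fin n) (Fin n) ℂ) (t : ℝ) (u : Fin n → ℂ) :
    star ((t : ℂ) • u) ⬝ᵥ M *ᵥ ((t : ℂ) • u) = ((t ^ 2 : ℝ) : ℂ) * (star u ⬝ᵥ M *ᵥ u) := by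
  rw [form_smul, Complex.star_def, Complex.conj_ofReal, ← Complex.ofReal_mul, sq]

theorem sum_norm_sq_real_smul {n : ℕ} (t : ℝ) (u : Fin n → ℂ) :
    ∑ i, ‖((t : ℂ) • u) i‖ ^ 2 = t ^ 2 * ∑ i, ‖u i‖ ^ 2 := by
  simp [mul_pow, Finset.mul_sum]

theorem inv_sqrt_sq {N : ℝ} (hN : 0 < N) : (√N)⁻¹ ^ 2 = N⁻¹ := by
  rw [inv_pow, Real.sq_sqrt hN.le]

theorem sum_norm_sq_pos {n : ℕ} {u : Fin n → ℂ} (hu : u ≠ 0) : 0 < ∑ i, ‖u i‖ ^ 2 := by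
  obtain ⟨i, hi⟩ := Function.ne_iff.1 hu
  exact Finset.sum_pos' (fun _ _ => by positivity)
    ⟨i, Finset.mem_univ i, by have := norm_pos_iff.2 hi; positivity⟩

theorem div_mem_numericalRange {n : ℕ} (A : Matrix (Fin n) (Fin n) ℂ) {u : Fin n → ℂ}
    (hu : u ≠ 0) : (∑ i, ‖u i‖ ^ 2)⁻¹ • (star u ⬝ᵥ A *ᵥ u) ∈ numericalRange A := by
  have hN := sum_norm_sq_pos hu
  refine ⟨(((√(∑ i, ‖u i‖ ^ 2))⁻¹ : ℝ) : ℂ) • u, ?_, ?_⟩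
  · rw [sum_norm_sq_real_smul, inv_sqrt_sq hN, inv_mul_cancel₀ hN.ne']
  · rw [form_real_smul_self, inv_sqrt_sq hN, Complex.real_smul]

theorem div_mem_realBild {n : ℕ} {H S : Matrix (Fin n) (Fin n) ℂ}
    (hH : H.IsHermitian) (hS : S.IsHermitian) {u v : Fin n → ℂ}
    (hN : 0 < ∑ i, ‖u i‖ ^ 2 + ∑ i, ‖v i‖ ^ 2) (h0 : star u ⬝ᵥ S *ᵥ v = 0)
    (h1 : star u ⬝ᵥ S *ᵥ u = star v ⬝ᵥ S *ᵥ v) :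
    (∑ i, ‖u i‖ ^ 2 + ∑ i, ‖v i‖ ^ 2)⁻¹ * ((star u ⬝ᵥ H *ᵥ u).re + (star v ⬝ᵥ H *ᵥ v).re) ∈
      realBild (H + Complex.I • S) := by
  set N := ∑ i, ‖u i‖ ^ 2 + ∑ i, ‖v i‖ ^ 2
  refine (mem_bild_add_I_smul_iff hH hS _).2
    ⟨(((√N)⁻¹ : ℝ) : ℂ) • u, (((√N)⁻¹ : ℝ) : ℂ) • v, ?_, ?_, ?_⟩
  · rw [sum_norm_sq_real_smul, sum_norm_sq_real_smul, ← mul_add, inv_sqrt_sq hN,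
      inv_mul_cancel₀ hN.ne']
  · rw [form_smul, h0, mul_zero]
  · simp only [form_real_smul_self, h1, sub_self, mul_zero, add_zero, inv_sqrt_sq hN]
    rw [hermitian_form_real hH u, hermitian_form_real hH v]
    push_cast
    simp only [Complex.ofReal_re]
    ring

/-- An `S`-isotropic vector suffices. For `n ≥ 2`, take orthonormal eigenvectors of `S`: eigenvalues
of one sign give a balanced pair, of opposite signs an isotropic sum. -/
theorem realBild_nonempty {n : ℕ} {H S : Matrix (Fin n) (Fin n) ℂ}
    (hn : 1 ≤ n) (hnS : n = 1 → S = 0) (hH : H.IsHermitian) (hS : S.IsHermitian) :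
    (realBild (H + Complex.I • S)).Nonempty := by
  have isotropic : ∀ u : Fin n → ℂ, u ≠ 0 → star u ⬝ᵥ S *ᵥ u = 0 →
      (realBild (H + Complex.I • S)).Nonempty := fun u hu h =>
    ⟨_, div_mem_realBild hH hS (u := u) (v := 0)
      (by simpa using sum_norm_sq_pos hu) (by simp) (by simpa using h)⟩
  rcases hn.eq_or_lt with h1 | h2
  · refine isotropic (fun _ => 1) (fun h => ?_) (by simp [hnS h1.symm])
    exact one_ne_zero (congrFun h ⟨0, hn⟩)
  · obtain ⟨i, j, hij⟩ : ∃ i j : Fin n, i ≠ j := ⟨⟨0, by omega⟩, ⟨1, h2⟩, by simp⟩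
    set l := hS.eigenvalues i
    set m := hS.eigenvalues j
    set e : Fin n → ℂ := (hS.eigenvectorBasis i).ofLp
    set f : Fin n → ℂ := (hS.eigenvectorBasis j).ofLp
    have hSe : S *ᵥ e = l • e := hS.mulVec_eigenvectorBasis i
    have hSf : S *ᵥ f = m • f := hS.mulVec_eigenvectorBasis j
    have hdot : ∀ a b, star (hS.eigenvectorBasis a).ofLp ⬝ᵥ (hS.eigenvectorBasis b).ofLp =
        if a = b then (1 : ℂ) else 0 := fun a b => by
      rw [dotProduct_comm, ← EuclideanSpace.inner_eq_star_dotProduct,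
        orthonormal_iff_ite.1 hS.eigenvectorBasis.orthonormal a b]
    have hee : star e ⬝ᵥ S *ᵥ e = l := by
      rw [hSe, dotProduct_smul, hdot, if_pos rfl, Complex.real_smul, mul_one]
    have hff : star f ⬝ᵥ S *ᵥ f = m := by
      rw [hSf, dotProduct_smul, hdot, if_pos rfl, Complex.real_smul, mul_one]
    have hef : star e ⬝ᵥ S *ᵥ f = 0 := by
      rw [hSf, dotProduct_smul, hdot, if_neg hij, smul_zero]
    have hfe : star f ⬝ᵥ S *ᵥ e = 0 := by
      rw [← hermitian_form_eq hS, hef, star_zero]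
    have he : e ≠ 0 := fun h => by simpa [e, h] using hdot i i
    have hf : f ≠ 0 := fun h => by simpa [f, h] using hdot j j
    rcases eq_or_ne l 0 with hl | hl
    · exact isotropic e he (by rw [hee, hl, Complex.ofReal_zero])
    rcases le_or_gt 0 (l * m) with hlm | hlm
    · have hv : (((√|l| : ℝ) : ℂ) • f) ≠ 0 :=
        smul_ne_zero (by simpa [Real.sqrt_eq_zero'] using hl) hf
      refine ⟨_, div_mem_realBild hH hS (u := ((√|m| : ℝ) : ℂ) • e) (v := ((√|l| : ℝ) : ℂ) • f)
        (add_pos_of_nonneg_of_pos (by positivity) (sum_norm_sq_pos hv)) ?_ ?_⟩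
      · rw [form_smul, hef, mul_zero]
      · rw [form_real_smul_self, form_real_smul_self, hee, hff, Real.sq_sqrt (abs_nonneg _),
          Real.sq_sqrt (abs_nonneg _), ← Complex.ofReal_mul, ← Complex.ofReal_mul]
        congr 1
        rcases hl.lt_or_gt with h | h
        · have : m ≤ 0 := by nlinarith
          rw [abs_of_neg h, abs_of_nonpos this]; ring
        · have : 0 ≤ m := by nlinarith
          rw [abs_of_pos h, abs_of_nonneg this]; ring
    · have hm : m ≠ 0 := fun h => by simp [h] at hlm
      have hSu : S *ᵥ (((√|m| : ℝ) : ℂ) • e + ((√|l| : ℝ) : ℂ) • f) =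
          ((√|m| : ℝ) : ℂ) • (S *ᵥ e) + ((√|l| : ℝ) : ℂ) • (S *ᵥ f) := by
        rw [Matrix.mulVec_add, Matrix.mulVec_smul, Matrix.mulVec_smul]
      refine isotropic (((√|m| : ℝ) : ℂ) • e + ((√|l| : ℝ) : ℂ) • f) (fun h => ?_) ?_
      -- Pairing with `e` through `S` isolates `√|m| * l`, which is nonzero.
      · have h0 := congrArg (fun x => star e ⬝ᵥ S *ᵥ x) h
        simp only [hSu, dotProduct_add, dotProduct_smul, hee, hef, Matrix.mulVec_zero,
          dotProduct_zero, mul_zero, add_zero, smul_eq_mul, mul_eq_zero, Complex.ofReal_eq_zero,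
          hl, or_false, Real.sqrt_eq_zero', abs_nonpos_iff] at h0
        exact hm h0
      · rw [hSu, star_add, star_smul, star_smul, add_dotProduct, smul_dotProduct, smul_dotProduct,
          dotProduct_add, dotProduct_add]
        simp only [dotProduct_smul, hee, hff, hef, hfe, mul_zero, add_zero, zero_add, smul_eq_mul,
          Complex.star_def, Complex.conj_ofReal, ← Complex.ofReal_mul, ← Complex.ofReal_add,
          ← mul_assoc, Real.mul_self_sqrt (abs_nonneg _)]
        rw [Complex.ofReal_eq_zero]
        rcases hl.lt_or_gt with h | h
        · have : 0 < m := by nlinarith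
          rw [abs_of_neg h, abs_of_pos this]; ring
        · have : m < 0 := by nlinarith
          rw [abs_of_pos h, abs_of_neg this]; ring

/-! ### Extremal real points and the two inclusions -/

theorem isLeast_realBild {n : ℕ} (A : Matrix (Fin n) (Fin n) ℂ) (h : (realBild A).Nonempty) :
    IsLeast (realBild A) (vMin A) :=
  (isCompact_realBild A).isLeast_sInf h

theorem isGreatest_realBild {n : ℕ} (A : Matrix (Fin n) (Fin n) ℂ) (h : (realBild A).Nonempty) :
    IsGreatest (realBild A) (vMax A) :=
  (isCompact_realBild A).isGreatest_sSup h

theorem realBild_subset_segment {n : ℕ} {A : Matrix (Fin n) (Fin n) ℂ} {r : ℝ}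
    (hr : r ∈ realBild A) : (r : ℂ) ∈ segment ℝ (vMin A : ℂ) (vMax A : ℂ) := by
  have h : r ∈ segment ℝ (vMin A) (vMax A) := by
    have h1 := (isLeast_realBild A ⟨r, hr⟩).2 hr
    have h2 := (isGreatest_realBild A ⟨r, hr⟩).2 hr
    rw [segment_eq_Icc (h1.trans h2)]
    exact ⟨h1, h2⟩
  obtain ⟨a, b, ha, hb, hab, rfl⟩ := h
  exact ⟨a, b, ha, hb, hab, by simp⟩

theorem upperBild_subset_convexHull {n : ℕ} {H S : Matrix (Fin n) (Fin n) ℂ}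
    (hH : H.IsHermitian) (hS : S.PosSemidef) :
    upperBild (H + Complex.I • S) ⊆ convexHull ℝ (numericalRange (H + Complex.I • S) ∪
      {(vMin (H + Complex.I • S) : ℂ), (vMax (H + Complex.I • S) : ℂ)}) := by
  set A := H + Complex.I • S with hA
  set C := convexHull ℝ (numericalRange A ∪ {(vMin A : ℂ), (vMax A : ℂ)})
  have hC : Convex ℝ C := convex_convexHull ℝ _
  have hreal : ∀ r ∈ realBild A, (r : ℂ) ∈ C := fun r hr =>
    hC.segment_subset (subset_convexHull ℝ _ (by simp)) (subset_convexHull ℝ _ (by simp))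
      (realBild_subset_segment hr)
  rintro z ⟨hz, him⟩
  obtain ⟨u, v, huv, h0, hzuv⟩ := (mem_bild_add_I_smul_iff hH hS.1 z).1 hz
  have hp := hermitian_form_real hS.1 u
  have hq := hermitian_form_real hS.1 v
  have ha := hermitian_form_real hH u
  have hb := hermitian_form_real hH v
  have hq0 : 0 ≤ (star v ⬝ᵥ S *ᵥ v).re :=
    (Complex.nonneg_iff.1 (hS.dotProduct_mulVec_nonneg v)).1
  have hAu : star u ⬝ᵥ A *ᵥ u = star u ⬝ᵥ H *ᵥ u + Complex.I * (star u ⬝ᵥ S *ᵥ u) :=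
    form_add_I_smul H S u u
  set p := (star u ⬝ᵥ S *ᵥ u).re
  set q := (star v ⬝ᵥ S *ᵥ v).re
  set a := (star u ⬝ᵥ H *ᵥ u).re with ha'
  set b := (star v ⬝ᵥ H *ᵥ v).re with hb'
  set U := ∑ i, ‖u i‖ ^ 2 with hU
  set V := ∑ i, ‖v i‖ ^ 2 with hV
  rw [hp, hq, ha, hb] at hzuv
  rw [ha, hp] at hAu
  have hqp : q ≤ p := by
    have h : 0 ≤ z.im := him
    rw [hzuv] at h
    simpa using h
  rcases (hq0.trans hqp).eq_or_lt with hp0 | hp0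
  · have hq0' : q = 0 := by linarith
    have : z = ((a + b : ℝ) : ℂ) := by rw [hzuv, ← hp0, hq0']; simp
    rw [this]
    apply hreal
    rw [this] at hz
    exact hz
  have hu : u ≠ 0 := by
    rintro rfl
    simp only [Matrix.mulVec_zero, dotProduct_zero] at hp
    exact hp0.ne (by exact_mod_cast hp)
  have hU0 : 0 < U := sum_norm_sq_pos hu
  have hw : U⁻¹ • (star u ⬝ᵥ A *ᵥ u) ∈ C :=
    subset_convexHull ℝ _ (Or.inl (div_mem_numericalRange A hu))
  -- Chosen so that `t • u` and `v` have equal `S`-values; `q ≤ p` makes `1 - t ^ 2` a nonnegative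
  -- weight.
  set t := √(q / p)
  have ht : t ^ 2 = q / p := Real.sq_sqrt (div_nonneg hq0 hp0.le)
  have ht1 : t ^ 2 ≤ 1 := by rw [ht]; exact (div_le_one hp0).2 hqp
  have htp : t ^ 2 * p = q := by rw [ht, div_mul_cancel₀ _ hp0.ne']
  have hV0 : 0 ≤ V := by positivity
  have hzeq : z = (1 - t ^ 2) • (star u ⬝ᵥ A *ᵥ u) + ((t ^ 2 * a + b : ℝ) : ℂ) := by
    rw [hzuv, hAu, ← htp, Complex.real_smul]
    push_cast
    ring
  -- If the real point has weight zero, the pair `(t • u, v)` cannot be normalized; then `v = 0`, `t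
  -- = 0`, and `z` itself lies in the complex numerical range.
  rcases (show 0 ≤ t ^ 2 * U + V by positivity).eq_or_lt with hN | hN
  · have hv : v = 0 := by
      by_contra hv
      have : 0 < V := sum_norm_sq_pos hv
      have : 0 ≤ t ^ 2 * U := by positivity
      linarith
    have hV : V = 0 := by simp [hV, hv]
    have ht0 : t ^ 2 = 0 := by
      rw [hV, add_zero] at hN
      exact (mul_eq_zero.1 hN.symm).resolve_right hU0.ne'
    have hU1 : U = 1 := by linarith
    have hb0 : b = 0 := by simp [hb', hv]
    rw [hzeq, ht0, hb0]
    simpa [hU1] using hw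
  · have hr := div_mem_realBild hH hS.1 (u := (t : ℂ) • u) (v := v)
      (by rw [sum_norm_sq_real_smul]; exact hN)
      (by
        have := form_smul S t 1 u v
        rwa [h0, mul_zero, one_smul] at this)
      (by rw [form_real_smul_self, hp, hq, ← htp, Complex.ofReal_mul])
    rw [sum_norm_sq_real_smul, form_real_smul_self, Complex.re_ofReal_mul] at hr
    have hcomb := hC hw (hreal _ hr) (a := (1 - t ^ 2) * U) (b := t ^ 2 * U + V)
      (mul_nonneg (by linarith) hU0.le) hN.le (by linarith)
    rw [smul_smul, mul_assoc, mul_inv_cancel₀ hU0.ne', mul_one, Complex.real_smul (x := _ + _),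
      ← Complex.ofReal_mul, ← hU, ← hV, ← mul_assoc, mul_inv_cancel₀ hN.ne', one_mul] at hcomb
    rw [hzeq]
    exact hcomb

theorem numericalRange_subset_upperBild {n : ℕ} {H S : Matrix (Fin n) (Fin n) ℂ}
    (hH : H.IsHermitian) (hS : S.PosSemidef) :
    numericalRange (H + Complex.I • S) ⊆ upperBild (H + Complex.I • S) := by
  rintro _ ⟨x, hx, rfl⟩
  refine ⟨(mem_bild_iff _ _).2 ⟨x, 0, by simpa using hx, by simp, by simp⟩, ?_⟩
  have h := (Complex.nonneg_iff.1 (hS.dotProduct_mulVec_nonneg x)).1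
  rw [form_add_I_smul, hermitian_form_real hH, hermitian_form_real hS.1]
  simpa using h

theorem convexHull_subset_upperBild {n : ℕ} {H S : Matrix (Fin n) (Fin n) ℂ} (hn : 1 ≤ n)
    (hH : H.IsHermitian) (hS : S.PosSemidef) (hne : (realBild (H + Complex.I • S)).Nonempty) :
    convexHull ℝ (numericalRange (H + Complex.I • S) ∪
      {(vMin (H + Complex.I • S) : ℂ), (vMax (H + Complex.I • S) : ℂ)}) ⊆
      upperBild (H + Complex.I • S) := by
  set A := H + Complex.I • S
  have hWne : (numericalRange A).Nonempty :=
    ⟨_, div_mem_numericalRange A (u := fun _ => 1)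
      fun h => one_ne_zero (congrFun h ⟨0, hn⟩)⟩
  -- Both pieces are convex, so the hull is their join.
  rw [convexHull_union hWne (by simp), (convex_numericalRange A).convexHull_eq, convexHull_pair]
  intro z hz
  obtain ⟨w, hw, r, hr, hz⟩ := mem_convexJoin.1 hz
  obtain ⟨hwB, hw0⟩ := numericalRange_subset_upperBild hH hS hw
  have hrB := segment_subset_bild A (isLeast_realBild A hne).1 (isGreatest_realBild A hne).1 hr
  obtain ⟨ρ, rfl⟩ : ∃ ρ : ℝ, (ρ : ℂ) = r := by
    obtain ⟨a, b, -, -, -, rfl⟩ := hr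
    exact ⟨a * vMin A + b * vMax A, by simp⟩
  rw [segment_symm] at hz
  refine ⟨segment_subset_bild A hrB hwB hz, ?_⟩
  obtain ⟨a, b, ha, hb, -, rfl⟩ := hz
  simpa using mul_nonneg hb hw0

theorem upperBild_eq_convexHull {n : ℕ} {H S : Matrix (Fin n) (Fin n) ℂ} (hn : 1 ≤ n)
    (hH : H.IsHermitian) (hS : S.PosSemidef) (hne : (realBild (H + Complex.I • S)).Nonempty) :
    upperBild (H + Complex.I • S) = convexHull ℝ (numericalRange (H + Complex.I • S) ∪
      {(vMin (H + Complex.I • S) : ℂ), (vMax (H + Complex.I • S) : ℂ)}) :=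
  (upperBild_subset_convexHull hH hS).antisymm (convexHull_subset_upperBild hn hH hS hne)

theorem corollary3p6 (n : ℕ) (A H S : Matrix (Fin n) (Fin n) ℂ)
    (hn : 1 ≤ n) (hnS : n = 1 → S = 0)
    (hH : H.IsHermitian) (hS : S.IsHermitian) (hA : A = H + Complex.I • S) :
    IsLeast (realBild A) (vMin A) ∧ IsGreatest (realBild A) (vMax A) ∧
    (S.PosSemidef →
      upperBild A =
        convexHull ℝ (numericalRange A ∪ {(vMin A : ℂ), (vMax A : ℂ)})) ∧
    ((-S).PosSemidef →
      upperBild A =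
        convexHull ℝ (numericalRange Aᴴ ∪ {(vMin A : ℂ), (vMax A : ℂ)})) := by
  have hne : (realBild A).Nonempty := by
    rw [hA]
    exact realBild_nonempty hn hnS hH hS
  refine ⟨isLeast_realBild A hne, isGreatest_realBild A hne, fun hpos => ?_, fun hneg => ?_⟩
  · rw [hA] at hne ⊢
    exact upperBild_eq_convexHull hn hH hpos hne
  · have hAH : Aᴴ = H + Complex.I • (-S) := by
      rw [hA, Matrix.conjTranspose_add, Matrix.conjTranspose_smul, hH.eq, hS.eq,
        Complex.star_def, Complex.conj_I, neg_smul, smul_neg]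
    have hupper : upperBild Aᴴ = upperBild A := by rw [upperBild, upperBild, bild_conjTranspose]
    have hreal : realBild Aᴴ = realBild A := by rw [realBild, realBild, bild_conjTranspose]
    have hmin : vMin Aᴴ = vMin A := by rw [vMin, vMin, hreal]
    have hmax : vMax Aᴴ = vMax A := by rw [vMax, vMax, hreal]
    have h := upperBild_eq_convexHull hn hH hneg (by rwa [← hAH, hreal])
    rwa [← hAH, hupper, hmin, hmax] at h
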